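/- Let $n\ge 1$, let $\mathbb P=\mathbb P(\mathbb C^{n+1})$ be complex projective space and $\mathbb P'=\mathbb P((\mathbb C^{n+1})^\vee)$ its dual. Let $\Omega\subset\mathbb P$ be non-empty and open and let $\Lambda\subset\mathbb P'$ be non-empty and closed (hence compact), such that $\boldsymbol\phi(\boldsymbol\omega)\neq 0$ for all $\phi\in\Lambda$, $\omega\in\Omega$, where bold letters denote arbitrary lifts; such a pair is called admissible. Suppose that $\Omega$ is saturated, i.e. $\Omega$ is the set of all points of $\mathbb P$ at which no form of $\Lambda$ vanishes. For $\omega,\omega'\in\Omega$ put $$d_\Lambda(\omega,\omega')=\ln\max_{\phi,\phi'\in\Lambda}\bigl|[\phi,\phi',\omega,\omega']\bigr|,\qquad [\phi,\phi',\omega,\omega']=\frac{\boldsymbol\phi(\boldsymbol\omega)\,\boldsymbol\phi'(\boldsymbol\omega')}{\boldsymbol\phi(\boldsymbol\omega')\,\boldsymbol\phi'(\boldsymbol\omega)}.$$ When $\omega\ne\omega'$ and $\ker\boldsymbol\phi$, $\ker\boldsymbol\phi'$ meet the line $(\omega\omega')$ at distinct points $a,b$, the number $[\phi,\phi',\omega,\omega']$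 is the cross-ratio of the four points $a,b,\omega,\omega'$ of that line, i.e. the coordinate of $\omega'$ when $a,b,\omega$ are placed at $\infty,0,1$. Then: (1) $\Omega$ is pseudo-convex, i.e. there is a continuous plurisubharmonic exhaustion function on $\Omega$. (2) For each $\omega_0\in\Omega$, the function $F\colon\omega\mapsto d_\Lambda(\omega_0,\omega)$ is plurisubharmonic on $\Omega$ (hence subharmonic in each affine chart). (3) If moreover the hyperplanes in $\Lambda$ have no point of $\mathbb P$ in common (i.e. the lifts of the elements of $\Lambda$ span $(\mathbb C^{n+1})^\vee$), then for each $\omega_0\in\Omega$ the function $F$ is an exhaustion function of $\Omega$: it is continuous and for every $c\in\mathbb R$ the set $\{\omega\in\Omega : F(\omega)<c\}$ is relatively compact in $\Omega$. -/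

import Mathlib

namespace ComplexHilbert

/-- The quotient topology on a projective space `P(V)`. -/
instance projTopology {K V : Type*} [DivisionRing K] [AddCommGroup V] [Module K V]
    [TopologicalSpace V] : TopologicalSpace (Projectivization K V) :=
  TopologicalSpace.coinduced (fun v : {v : V // v ≠ 0} => Projectivization.mk K v.1 v.2)
    inferInstance

/-- The complex projective space `P(ℂ^{n+1})`. -/
abbrev CP (n : ℕ) : Type := Projectivization ℂ (Fin (n + 1) → ℂ)

/-- The dual projective space `P((ℂ^{n+1})^∨)`; every linear form on `ℂ^{n+1}` is continuous. -/
abbrev CPDual (n : ℕ) : Type := Projectivization ℂ ((Fin (n + 1) → ℂ) →L[ℂ] ℂ)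

/-- The (projective class of a) form `φ` vanishes at the point `ω`, i.e. `ω` lies on the
hyperplane defined by `φ`. -/
def Vanishes {n : ℕ} (φ : CPDual n) (ω : CP n) : Prop := φ.rep ω.rep = 0

/-- Vanishing can be tested on arbitrary lifts. -/
theorem vanishes_mk {n : ℕ} (f : (Fin (n + 1) → ℂ) →L[ℂ] ℂ) (hf : f ≠ 0)
    (v : Fin (n + 1) → ℂ) (hv : v ≠ 0) :
    Vanishes (Projectivization.mk ℂ f hf) (Projectivization.mk ℂ v hv) ↔ f v = 0 := by
  obtain ⟨a, ha⟩ := Projectivization.exists_smul_eq_mk_rep ℂ f hf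
  obtain ⟨b, hb⟩ := Projectivization.exists_smul_eq_mk_rep ℂ v hv
  unfold Vanishes
  rw [← ha, ← hb]
  simp [Units.smul_def]

/-- An admissible pair: non-empty sets `Ω ⊆ P`, `Λ ⊆ P'` with `Ω` open, `Λ` closed, such that
no form of `Λ` vanishes at a point of `Ω`. -/
structure IsAdmissible {n : ℕ} (Ω : Set (CP n)) (Λ : Set (CPDual n)) : Prop where
  nonempty_left : Ω.Nonempty
  nonempty_right : Λ.Nonempty
  isOpen : IsOpen Ω
  isClosed : IsClosed Λ
  not_vanishes : ∀ ω ∈ Ω, ∀ φ ∈ Λ, ¬ Vanishes φ ω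

/-- `Ω` is saturated: it is the set of all points at which no form of `Λ` vanishes. -/
def IsSaturated {n : ℕ} (Ω : Set (CP n)) (Λ : Set (CPDual n)) : Prop :=
  Ω = {ω | ∀ φ ∈ Λ, ¬ Vanishes φ ω}

/-- The cross-ratio `[φ, φ', ω, ω'] = φ(ω) φ'(ω') / (φ(ω') φ'(ω))`, computed on lifts. -/
noncomputable def crossRatio {n : ℕ} (φ φ' : CPDual n) (ω ω' : CP n) : ℂ :=
  (φ.rep ω.rep * φ'.rep ω'.rep) / (φ.rep ω'.rep * φ'.rep ω.rep)

/-- The cross-ratio can be computed on arbitrary lifts. -/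
theorem crossRatio_mk {n : ℕ} (f f' : (Fin (n + 1) → ℂ) →L[ℂ] ℂ) (hf : f ≠ 0) (hf' : f' ≠ 0)
    (v v' : Fin (n + 1) → ℂ) (hv : v ≠ 0) (hv' : v' ≠ 0) :
    crossRatio (Projectivization.mk ℂ f hf) (Projectivization.mk ℂ f' hf')
      (Projectivization.mk ℂ v hv) (Projectivization.mk ℂ v' hv') =
      (f v * f' v') / (f v' * f' v) := by
  obtain ⟨a, ha⟩ := Projectivization.exists_smul_eq_mk_rep ℂ f hf
  obtain ⟨a', ha'⟩ := Projectivization.exists_smul_eq_mk_rep ℂ f' hf'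
  obtain ⟨b, hb⟩ := Projectivization.exists_smul_eq_mk_rep ℂ v hv
  obtain ⟨b', hb'⟩ := Projectivization.exists_smul_eq_mk_rep ℂ v' hv'
  unfold crossRatio
  rw [← ha, ← ha', ← hb, ← hb']
  simp only [Units.smul_def, map_smul, FunLike.coe_smul, Pi.smul_apply, smul_eq_mul]
  have h : (a : ℂ) * a' * b * b' ≠ 0 := by simp
  rw [← mul_div_mul_left (f v * f' v') (f v' * f' v) h]
  congr 1 <;> ring

/-- `t` is the cross-ratio of four collinear points `a, b, c, d` (with `a, b, c` distinct): in a
suitable projective coordinate of their common line they are `∞, 0, 1, t`. -/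
def IsCrossRatio {n : ℕ} (a b c d : CP n) (t : ℂ) : Prop :=
  ∃ e f : Fin (n + 1) → ℂ, LinearIndependent ℂ ![e, f] ∧
    a.submodule = Submodule.span ℂ {e} ∧ b.submodule = Submodule.span ℂ {f} ∧
    c.submodule = Submodule.span ℂ {e + f} ∧ d.submodule = Submodule.span ℂ {t • e + f}

/-- `crossRatio φ φ' ω ω'` is the cross-ratio of `ker φ ∩ (ωω'), ker φ' ∩ (ωω'), ω, ω'` on the
line `(ωω')`. -/
theorem isCrossRatio_iff {n : ℕ} (φ φ' : CPDual n) (ω ω' a b : CP n) (hω : ω ≠ ω')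
    (h1 : ¬ Vanishes φ ω) (h2 : ¬ Vanishes φ ω') (h3 : ¬ Vanishes φ' ω) (h4 : ¬ Vanishes φ' ω')
    (ha : a.submodule ≤ ω.submodule ⊔ ω'.submodule) (hφa : Vanishes φ a)
    (hb : b.submodule ≤ ω.submodule ⊔ ω'.submodule) (hφb : Vanishes φ' b)
    (hab : a ≠ b) (t : ℂ) :
    IsCrossRatio a b ω ω' t ↔ t = crossRatio φ φ' ω ω' := by
  have hs : ∀ (x y : Fin (n + 1) → ℂ) (c d : ℂ), c ≠ 0 → d ≠ 0 → c • x = d • y →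
      Submodule.span ℂ {x} = Submodule.span ℂ {y} := by
    intro x y c d hc hd h
    rw [← Submodule.span_singleton_smul_eq (IsUnit.mk0 c hc) x, h,
      Submodule.span_singleton_smul_eq (IsUnit.mk0 d hd) y]
  have hvw : LinearIndependent ℂ ![ω.rep, ω'.rep] := by
    have h := Projectivization.linearIndependent_pair_iff_ne.2 hω
    convert h using 1
  have hline : ∀ (ψ : CPDual n) (p : CP n), ¬ Vanishes ψ ω → ¬ Vanishes ψ ω' →
      p.submodule ≤ ω.submodule ⊔ ω'.submodule → Vanishes ψ p →
      p.submodule = Submodule.span ℂ {ψ.rep ω'.rep • ω.rep - ψ.rep ω.rep • ω'.rep} := by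
    intro ψ p k1 k2 hp hz
    rw [Projectivization.submodule_eq p] at hp ⊢
    have hmem := hp (Submodule.mem_span_singleton_self _)
    rw [Projectivization.submodule_eq ω, Projectivization.submodule_eq ω',
      Submodule.mem_sup] at hmem
    obtain ⟨y, hy, z, hz', hyz⟩ := hmem
    obtain ⟨r, rfl⟩ := Submodule.mem_span_singleton.1 hy
    obtain ⟨q, rfl⟩ := Submodule.mem_span_singleton.1 hz'
    have h0 := hz
    unfold Vanishes at h0 k1 k2
    rw [← hyz, map_add, map_smul, map_smul, smul_eq_mul, smul_eq_mul] at h0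
    have hr : r ≠ 0 := by
      rintro rfl
      have hq : q = 0 := by
        simpa [k2] using h0
      apply Projectivization.rep_nonzero p
      rw [← hyz, hq]
      simp
    refine hs _ _ (ψ.rep ω'.rep) r k2 hr ?_
    rw [← hyz]
    have : ψ.rep ω'.rep * q = - (r * ψ.rep ω.rep) := by linear_combination h0
    rw [smul_add, smul_sub, smul_smul, smul_smul, smul_smul, smul_smul, this, mul_comm r (ψ.rep ω.rep)]
    rw [neg_smul, sub_eq_add_neg, mul_comm r (ψ.rep ω'.rep)]
  have hA := hline φ a h1 h2 ha hφa
  have hB := hline φ' b h3 h4 hb hφb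
  unfold Vanishes at h1 h2 h3 h4
  unfold IsCrossRatio crossRatio
  rw [hA, hB, Projectivization.submodule_eq ω, Projectivization.submodule_eq ω']
  have hD : φ.rep ω'.rep * φ'.rep ω.rep - φ.rep ω.rep * φ'.rep ω'.rep ≠ 0 := by
    intro h
    apply hab
    apply Projectivization.submodule_injective
    rw [hA, hB]
    refine hs _ _ (φ'.rep ω.rep) (φ.rep ω.rep) h3 h1 ?_
    rw [smul_sub, smul_sub, smul_smul, smul_smul, smul_smul, smul_smul]
    congr 2
    · linear_combination h
    · ring
  generalize ω.rep = v at *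
  generalize ω'.rep = w at *
  generalize φ.rep = f at *
  generalize φ'.rep = g at *
  rw [LinearIndependent.pair_iff] at hvw
  constructor
  · rintro ⟨e, k, -, ka, kb, kc, kd⟩
    obtain ⟨α, rfl⟩ := Submodule.span_singleton_eq_span_singleton.1 ka
    obtain ⟨β, rfl⟩ := Submodule.span_singleton_eq_span_singleton.1 kb
    obtain ⟨γ, hγ⟩ := Submodule.span_singleton_eq_span_singleton.1 kc
    obtain ⟨δ, hδ⟩ := Submodule.span_singleton_eq_span_singleton.1 kd
    simp only [Units.smul_def] at hγ hδ
    have e1 := (hvw (α * f w + β * g w - γ) (-(α * f v + β * g v)) (by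
      rw [← sub_eq_zero] at hγ
      rw [← neg_eq_zero, ← hγ]
      module)).2
    have e2 := (hvw (t * α * f w + β * g w) (-(t * α * f v + β * g v) - δ) (by
      rw [← sub_eq_zero] at hδ
      rw [← neg_eq_zero, ← hδ]
      module)).1
    rw [eq_div_iff (mul_ne_zero h2 h3)]
    have hα : (α : ℂ) ≠ 0 := α.ne_zero
    apply mul_left_cancel₀ hα
    linear_combination g v * e2 + g w * e1
  · intro ht
    rw [eq_div_iff (mul_ne_zero h2 h3)] at ht
    refine ⟨g v • (f w • v - f v • w), -(f v) • (g w • v - g v • w), ?_, ?_, ?_, ?_, ?_⟩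
    · rw [LinearIndependent.pair_iff]
      intro x y hxy
      obtain ⟨k1, k2⟩ := hvw (x * g v * f w - y * f v * g w) (-(x * g v * f v) + y * f v * g v) (by
        rw [← hxy]
        module)
      have hx : x = y := by
        apply mul_right_cancel₀ (mul_ne_zero h1 h3)
        linear_combination -k2
      subst hx
      have : x = 0 := by
        apply (mul_eq_zero.1 (show x * (f w * g v - f v * g w) = 0 by
          linear_combination k1)).resolve_right hD
      exact ⟨this, this⟩
    · exact hs _ _ (g v) 1 h3 one_ne_zero (by simp)
    · exact hs _ _ (-(f v)) 1 (neg_ne_zero.2 h1) one_ne_zero (by simp)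
    · refine hs _ _ (f w * g v - f v * g w) 1 hD one_ne_zero ?_
      module
    · have ht1 : t - 1 ≠ 0 := by
        intro h
        apply hD
        have : t = 1 := by linear_combination h
        rw [this] at ht
        linear_combination ht
      refine hs _ _ (-(f v * g v * (t - 1))) 1
        (neg_ne_zero.2 (mul_ne_zero (mul_ne_zero h1 h3) ht1)) one_ne_zero ?_
      have : (t * g v * f w - f v * g w) • v = 0 := by
        rw [show t * g v * f w - f v * g w = 0 by linear_combination ht, zero_smul]
      rw [← sub_eq_zero, ← neg_eq_zero, ← this]
      module

/-- The generalized Hilbert pseudo-metric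
`d_Λ(ω, ω') = ln max {|[φ, φ', ω, ω']| : φ, φ' ∈ Λ}`. -/
noncomputable def hilbertDist {n : ℕ} (Λ : Set (CPDual n)) (ω ω' : CP n) : ℝ :=
  Real.log (sSup {r : ℝ | ∃ φ ∈ Λ, ∃ φ' ∈ Λ, r = ‖crossRatio φ φ' ω ω'‖})

/-- A real-valued function on a subset `U` of a complex vector space is plurisubharmonic if it is
upper semicontinuous and satisfies the sub-mean value inequality on every closed complex disc
contained in `U`. (Integrability on the boundary circle is automatic for a real-valued
plurisubharmonic function; it is listed so that the mean value is a genuine one.) -/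
def IsPlurisubharmonicOn {E : Type*} [AddCommGroup E] [Module ℂ E] [TopologicalSpace E]
    (u : E → ℝ) (U : Set E) : Prop :=
  UpperSemicontinuousOn u U ∧
    ∀ a b : E, (∀ ζ : ℂ, ‖ζ‖ ≤ 1 → a + ζ • b ∈ U) →
      CircleIntegrable (fun ζ : ℂ => u (a + ζ • b)) 0 1 ∧
        u a ≤ Real.circleAverage (fun ζ : ℂ => u (a + ζ • b)) 0 1

/-- The `i`-th standard affine chart `ℂⁿ → P`,
`z ↦ [z₀ : … : z_{i-1} : 1 : z_i : … : z_{n-1}]`. -/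
noncomputable def affineChart {n : ℕ} (i : Fin (n + 1)) (z : Fin n → ℂ) : CP n :=
  Projectivization.mk ℂ (i.insertNth (1 : ℂ) z : Fin (n + 1) → ℂ) (fun h => by
    have := congrFun h i
    simp at this)

/-- A real-valued function on a subset of projective space is plurisubharmonic if it is so in each
standard affine chart. -/
def IsPSHOn {n : ℕ} (u : CP n → ℝ) (Ω : Set (CP n)) : Prop :=
  ∀ i : Fin (n + 1),
    IsPlurisubharmonicOn (fun z => u (affineChart i z)) {z | affineChart i z ∈ Ω}

/-- `u` is an exhaustion function of `Ω`: it is continuous and each sublevel set `{u < c}` is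
relatively compact in `Ω`. -/
def IsExhaustionOn {X : Type*} [TopologicalSpace X] (u : X → ℝ) (Ω : Set X) : Prop :=
  ContinuousOn u Ω ∧ ∀ c : ℝ, ∃ K : Set X, IsCompact K ∧ K ⊆ Ω ∧ {x ∈ Ω | u x < c} ⊆ K

/-- An open subset of projective space is pseudo-convex if it carries a continuous plurisubharmonic
exhaustion function. -/
def IsPseudoconvex {n : ℕ} (Ω : Set (CP n)) : Prop :=
  IsOpen Ω ∧ ∃ u : CP n → ℝ, IsPSHOn u Ω ∧ IsExhaustionOn u Ω

end ComplexHilbert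

/-!
Lifting the forms of `Λ` so that they take the value `1` at a lift of `ω₀` turns `d_Λ(ω₀, ·)` into
`log sup |ψ / φ|`, where `φ` and `ψ` range over a compact set of linear forms and `φ` has no zero on
`Ω`. Each `ψ / φ` is holomorphic on the lift of `Ω`, so Jensen's formula, applied to a quotient
attaining the supremum at the centre of a disc, gives the sub-mean value inequality. If the
numerators `ψ` have no common zero, then `sup |ψ / φ| ≤ C` forces `φ ≠ 0`, so that the set defined
by `|ψ| ≤ C |φ|` is a closed, hence compact, subset of the projective space contained in `Ω`, and
the supremum is an exhaustion. For pseudo-convexity the numerators are the coordinate forms.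
-/

namespace ComplexHilbert

open Set Metric Topology

section Projective

variable {K V : Type*} [DivisionRing K] [AddCommGroup V] [Module K V]

theorem apply_rep_mk {α : Type*} {u : V → α} (hu : ∀ (a : Kˣ) (v : V), u (a • v) = u v) {v : V}
    (hv : v ≠ 0) : u (Projectivization.mk K v hv).rep = u v := by
  obtain ⟨a, ha⟩ := Projectivization.exists_smul_eq_mk_rep K v hv
  rw [← ha, hu]

theorem rep_mk_mem_iff {S : Set V} (hS : ∀ (a : Kˣ) (v : V), a • v ∈ S ↔ v ∈ S) {v : V}
    (hv : v ≠ 0) : (Projectivization.mk K v hv).rep ∈ S ↔ v ∈ S :=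
  (apply_rep_mk (u := (· ∈ S)) (fun a v => propext (hS a v)) hv).to_iff

variable [TopologicalSpace V]

theorem isQuotientMap_mk :
    IsQuotientMap (fun v : {v : V // v ≠ 0} => Projectivization.mk K v.1 v.2) :=
  ⟨⟨rfl⟩, fun p => ⟨⟨p.rep, p.rep_nonzero⟩, p.mk_rep⟩⟩

theorem isOpen_preimage_rep {S : Set V} (hS : ∀ (a : Kˣ) (v : V), a • v ∈ S ↔ v ∈ S)
    (hopen : IsOpen S) : IsOpen (Projectivization.rep (K := K) ⁻¹' S) := by
  rw [← isQuotientMap_mk.isOpen_preimage]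
  convert hopen.preimage (continuous_subtype_val (p := fun v : V => v ≠ 0)) using 1
  ext v
  exact rep_mk_mem_iff hS v.2

theorem isClosed_preimage_rep {S : Set V} (hS : ∀ (a : Kˣ) (v : V), a • v ∈ S ↔ v ∈ S)
    (hclosed : IsClosed S) : IsClosed (Projectivization.rep (K := K) ⁻¹' S) := by
  rw [← isOpen_compl_iff, ← preimage_compl]
  exact isOpen_preimage_rep (fun a v => (hS a v).not) hclosed.isOpen_compl

theorem continuousOn_comp_rep {α : Type*} [TopologicalSpace α] {u : V → α} {S : Set V}
    (hu : ∀ (a : Kˣ) (v : V), u (a • v) = u v) (hS : ∀ (a : Kˣ) (v : V), a • v ∈ S ↔ v ∈ S)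
    (hopen : IsOpen S) (hcont : ContinuousOn u S) :
    ContinuousOn (fun p : Projectivization K V => u p.rep) (Projectivization.rep ⁻¹' S) := by
  rw [isQuotientMap_mk.continuousOn_isOpen_iff (isOpen_preimage_rep hS hopen)]
  exact (hcont.comp continuous_subtype_val.continuousOn
    fun v hv => (rep_mk_mem_iff hS v.2).1 hv).congr fun v _ => apply_rep_mk hu v.2

theorem compactSpace_projectivization {𝕜 V : Type*} [RCLike 𝕜] [NormedAddCommGroup V]
    [NormedSpace 𝕜 V] [ProperSpace V] : CompactSpace (Projectivization 𝕜 V) := by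
  have hcont : Continuous fun v : sphere (0 : V) 1 =>
      Projectivization.mk 𝕜 v.1 (ne_zero_of_mem_unit_sphere v) :=
    isQuotientMap_mk.continuous.comp
      (continuous_subtype_val.subtype_mk fun v => ne_zero_of_mem_unit_sphere v)
  refine Function.Surjective.compactSpace hcont fun p => ?_
  refine ⟨⟨(‖p.rep‖⁻¹ : 𝕜) • p.rep, by simp [norm_smul_inv_norm p.rep_nonzero]⟩, ?_⟩
  conv_rhs => rw [← p.mk_rep]
  exact (Projectivization.mk_eq_mk_iff' 𝕜 _ _ _ _).2 ⟨_, rfl⟩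

end Projective

section SubMeanValue

variable {h : ℂ → ℂ} {c : ℂ} {R : ℝ}

theorem log_norm_le_circleAverage_log_norm (hR : R ≠ 0)
    (han : AnalyticOnNhd ℂ h (closedBall c |R|)) (hc : h c ≠ 0) :
    Real.log ‖h c‖ ≤ Real.circleAverage (fun ζ => Real.log ‖h ζ‖) c R := by
  -- By Jensen's formula the difference is a sum of nonnegative terms indexed by the zeros of `h`.
  rw [han.circleAverage_log_norm hR hc]
  refine le_add_of_nonneg_left (finsum_nonneg fun u => ?_)
  by_cases hu : u ∈ closedBall c |R|
  · refine mul_nonneg (mod_cast (MeromorphicOn.AnalyticOnNhd.divisor_nonneg han) u) ?_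
    rcases eq_or_ne u c with rfl | huc
    · simp
    have hdist : 0 < ‖c - u‖ := norm_pos_iff.2 (sub_ne_zero.2 huc.symm)
    rw [← Real.log_abs, abs_mul, abs_inv, abs_norm]
    refine Real.log_nonneg ((one_le_div₀ hdist).2 ?_)
    rwa [mem_closedBall, dist_comm, dist_eq_norm] at hu
  · simp [hu]

/-- Since `Real.log 0 = 0`, nothing may be asked of `g` at the zeros of `h`. -/
theorem log_norm_le_circleAverage_of_le (hR : R ≠ 0)
    (han : AnalyticOnNhd ℂ h (closedBall c |R|)) (hc : h c ≠ 0) {g : ℂ → ℝ}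
    (hg : CircleIntegrable g c R)
    (hle : ∀ ζ ∈ sphere c |R|, h ζ ≠ 0 → Real.log ‖h ζ‖ ≤ g ζ) :
    Real.log ‖h c‖ ≤ Real.circleAverage g c R := by
  have hne : ∀ᶠ ζ in Filter.codiscreteWithin (sphere c |R|), h ζ ≠ 0 :=
    Filter.codiscreteWithin_mono sphere_subset_closedBall <|
      han.preimage_zero_mem_codiscreteWithin hc (mem_closedBall_self (abs_nonneg R))
        ((convex_closedBall c |R|).isConnected (nonempty_closedBall.2 (abs_nonneg R)))
  have hmax : g =ᶠ[Filter.codiscreteWithin (sphere c |R|)] fun ζ => max (g ζ) (Real.log ‖h ζ‖) := by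
    filter_upwards [hne, Filter.self_mem_codiscreteWithin _] with ζ hζ hmem
    exact (max_eq_left (hle ζ hmem hζ)).symm
  have hint : CircleIntegrable (fun ζ => Real.log ‖h ζ‖) c R :=
    (han.mono sphere_subset_closedBall).meromorphicOn.circleIntegrable_log_norm
  calc Real.log ‖h c‖ ≤ Real.circleAverage (fun ζ => Real.log ‖h ζ‖) c R :=
        log_norm_le_circleAverage_log_norm hR han hc
    _ ≤ Real.circleAverage (fun ζ => max (g ζ) (Real.log ‖h ζ‖)) c R :=
        Real.circleAverage_mono hint (hg.congr_codiscreteWithin hmax) fun _ _ => le_max_right _ _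
    _ = Real.circleAverage g c R := (Real.circleAverage_congr_codiscreteWithin hmax hR).symm

end SubMeanValue

section CompactSup

theorem continuousOn_sSup_image {X Y α : Type*} [TopologicalSpace X] [TopologicalSpace Y]
    [ConditionallyCompleteLinearOrder α] [TopologicalSpace α] [OrderTopology α]
    {S : Set X} {U : Set Y} (hS : IsCompact S) {f : X → Y → α}
    (hf : ContinuousOn (fun p : X × Y => f p.1 p.2) (S ×ˢ U)) :
    ContinuousOn (fun y => sSup ((f · y) '' S)) U := by
  rw [continuousOn_iff_continuous_domRestrict]
  have := isCompact_iff_compactSpace.1 hS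
  have hcont : Continuous fun p : U × S => f p.2 p.1 :=
    hf.comp_continuous (f := fun p : U × S => (p.2.1, p.1.1)) (by fun_prop)
      fun p => ⟨p.2.2, p.1.2⟩
  convert (isCompact_univ (X := S)).continuous_sSup (f := fun (y : U) (x : S) => f x y) hcont
    using 2 with y
  rw [domRestrict_apply, image_univ, image_eq_range]

variable {X Y G : Type*} [TopologicalSpace X] [TopologicalSpace Y] [NormedAddCommGroup G]
  {S : Set X} {U : Set Y} {F : X → Y → G}

theorem isCompact_image_norm (hS : IsCompact S)
    (hF : ContinuousOn (fun p : X × Y => ‖F p.1 p.2‖) (S ×ˢ U)) {y : Y} (hy : y ∈ U) :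
    IsCompact ((fun x => ‖F x y‖) '' S) :=
  hS.image_of_continuousOn
    (hF.comp (f := fun x => (x, y)) (by fun_prop) fun _ hx => ⟨hx, hy⟩)

theorem norm_le_sSup_image_norm (hS : IsCompact S)
    (hF : ContinuousOn (fun p : X × Y => ‖F p.1 p.2‖) (S ×ˢ U)) {y : Y} (hy : y ∈ U)
    {x : X} (hx : x ∈ S) : ‖F x y‖ ≤ sSup ((fun x => ‖F x y‖) '' S) :=
  le_csSup (isCompact_image_norm hS hF hy).bddAbove (mem_image_of_mem _ hx)

theorem sSup_image_norm_pos (hS : IsCompact S)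
    (hF : ContinuousOn (fun p : X × Y => ‖F p.1 p.2‖) (S ×ˢ U)) {y : Y} (hy : y ∈ U)
    (hne : ∃ x ∈ S, F x y ≠ 0) : 0 < sSup ((fun x => ‖F x y‖) '' S) :=
  let ⟨_, hx, hxy⟩ := hne
  (norm_pos_iff.2 hxy).trans_le (norm_le_sSup_image_norm hS hF hy hx)

theorem continuousOn_log_sSup_image_norm (hS : IsCompact S)
    (hF : ContinuousOn (fun p : X × Y => ‖F p.1 p.2‖) (S ×ˢ U))
    (hne : ∀ y ∈ U, ∃ x ∈ S, F x y ≠ 0) :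
    ContinuousOn (fun y => Real.log (sSup ((fun x => ‖F x y‖) '' S))) U :=
  (continuousOn_sSup_image hS hF).log fun y hy => (sSup_image_norm_pos hS hF hy (hne y hy)).ne'

theorem isPlurisubharmonicOn_log_sSup_image_norm {E : Type*} [NormedAddCommGroup E]
    [NormedSpace ℂ E] {U : Set E} {F : X → E → ℂ} (hS : IsCompact S)
    (hF : ContinuousOn (fun p : X × E => ‖F p.1 p.2‖) (S ×ˢ U))
    (han : ∀ x ∈ S, AnalyticOnNhd ℂ (F x) U) (hne : ∀ v ∈ U, ∃ x ∈ S, F x v ≠ 0) :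
    IsPlurisubharmonicOn (fun v => Real.log (sSup ((fun x => ‖F x v‖) '' S))) U := by
  have hcont := continuousOn_log_sSup_image_norm hS hF hne
  refine ⟨hcont.upperSemicontinuousOn, fun a b hdisc => ?_⟩
  have hmaps : MapsTo (fun ζ : ℂ => a + ζ • b) (closedBall 0 |1|) U := fun ζ hζ =>
    hdisc ζ (by simpa using hζ)
  have hmaps' := hmaps.mono_left sphere_subset_closedBall
  have hint : CircleIntegrable
      (fun ζ : ℂ => Real.log (sSup ((fun x => ‖F x (a + ζ • b)‖) '' S))) 0 1 :=
    (hcont.comp (f := fun ζ : ℂ => a + ζ • b) (by fun_prop)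
      (by simpa using hmaps')).circleIntegrable zero_le_one
  refine ⟨hint, ?_⟩
  have ha : a ∈ U := by simpa using hdisc 0 (by simp)
  obtain ⟨y, hy, hya⟩ := hne a ha
  obtain ⟨x, hx, hmax : ‖F x a‖ = sSup ((fun x => ‖F x a‖) '' S)⟩ :=
    (isCompact_image_norm hS hF ha).sSup_mem ⟨_, mem_image_of_mem _ hy⟩
  have hxa : F x a ≠ 0 := norm_pos_iff.1 (hmax ▸ sSup_image_norm_pos hS hF ha ⟨y, hy, hya⟩)
  have hline : AnalyticOnNhd ℂ (fun ζ : ℂ => F x (a + ζ • b)) (closedBall 0 |1|) :=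
    (han x hx).comp (fun ζ _ => by fun_prop) hmaps
  beta_reduce
  rw [← hmax]
  simpa using log_norm_le_circleAverage_of_le one_ne_zero hline (by simpa using hxa) hint
    fun ζ hζ h0 =>
      Real.log_le_log (norm_pos_iff.2 h0) (norm_le_sSup_image_norm hS hF (hmaps' hζ) hx)

end CompactSup

section AffineCharts

theorem IsPlurisubharmonicOn.comp_affineMap {E F : Type*} [AddCommGroup E] [Module ℂ E]
    [TopologicalSpace E] [AddCommGroup F] [Module ℂ F] [TopologicalSpace F] {u : F → ℝ}
    {U : Set F} (hu : IsPlurisubharmonicOn u U) {f : E →ᵃ[ℂ] F} (hf : Continuous f) :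
    IsPlurisubharmonicOn (u ∘ f) (f ⁻¹' U) := by
  refine ⟨hu.1.comp hf.continuousOn (mapsTo_preimage f U), fun a b hdisc => ?_⟩
  have hline (ζ : ℂ) : f (a + ζ • b) = f a + ζ • f.linear b := by
    simpa [add_comm] using f.map_vadd a (ζ • b)
  simp only [mem_preimage, Function.comp_apply, hline] at hdisc ⊢
  exact hu.2 (f a) (f.linear b) hdisc

variable {n : ℕ}

/-- The lift `z ↦ (z₀, …, z_{i-1}, 1, z_i, …, z_{n-1})` of the chart `affineChart i` to `ℂⁿ⁺¹`,
as an affine map, so that plurisubharmonic functions can be pulled back along it. -/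
noncomputable def affineChartLift (i : Fin (n + 1)) : (Fin n → ℂ) →ᵃ[ℂ] (Fin (n + 1) → ℂ) where
  toFun z := i.insertNth 1 z
  linear := LinearMap.pi (i.insertNth 0 LinearMap.proj)
  map_vadd' z w := by
    ext j
    refine i.succAboveCases ?_ (fun k => ?_) j <;> simp

theorem isPSHOn_comp_rep {u : (Fin (n + 1) → ℂ) → ℝ} {S : Set (Fin (n + 1) → ℂ)}
    (hu : ∀ (a : ℂˣ) (v : Fin (n + 1) → ℂ), u (a • v) = u v)
    (hS : ∀ (a : ℂˣ) (v : Fin (n + 1) → ℂ), a • v ∈ S ↔ v ∈ S)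
    (hpsh : IsPlurisubharmonicOn u S) :
    IsPSHOn (fun ω => u ω.rep) (Projectivization.rep ⁻¹' S) := by
  intro i
  have hcont : Continuous (affineChartLift i) := AffineMap.continuous_of_finiteDimensional _
  convert hpsh.comp_affineMap hcont using 1
  · ext z
    exact apply_rep_mk hu _
  · ext z
    exact rep_mk_mem_iff hS _

end AffineCharts

section RatioOfForms

variable {E : Type*} [NormedAddCommGroup E] [NormedSpace ℂ E] {Φ Ψ : Set (E →L[ℂ] ℂ)}

/-- The vectors at which no form of `Φ` vanishes and some form of `Ψ` does not vanish, so that for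
compact `Φ ≠ ∅` and `Ψ` the number `supRatio Φ Ψ v` is a genuine supremum and is positive. -/
def ratioDomain (Φ Ψ : Set (E →L[ℂ] ℂ)) : Set E :=
  {v | (∀ φ ∈ Φ, φ v ≠ 0) ∧ ∃ ψ ∈ Ψ, ψ v ≠ 0}

/-- The supremum of `|ψ v / φ v|` over the forms `φ ∈ Φ` and `ψ ∈ Ψ`. Both the Hilbert
pseudo-metric and the exhaustion function of a saturated set are logarithms of such suprema. -/
noncomputable def supRatio (Φ Ψ : Set (E →L[ℂ] ℂ)) (v : E) : ℝ :=
  sSup ((fun p : (E →L[ℂ] ℂ) × (E →L[ℂ] ℂ) => ‖p.2 v / p.1 v‖) '' Φ ×ˢ Ψ)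

theorem supRatio_smul (a : ℂˣ) (v : E) : supRatio Φ Ψ (a • v) = supRatio Φ Ψ v := by
  simp only [supRatio, Units.smul_def, map_smul, smul_eq_mul, mul_div_mul_left _ _ a.ne_zero]

theorem smul_mem_ratioDomain_iff (a : ℂˣ) (v : E) :
    a • v ∈ ratioDomain Φ Ψ ↔ v ∈ ratioDomain Φ Ψ := by
  simp [ratioDomain, Units.smul_def]

theorem isOpen_ratioDomain (hΦ : IsCompact Φ) : IsOpen (ratioDomain Φ Ψ) := by
  have hnonvanishing : IsOpen {v : E | ∀ φ ∈ Φ, φ v ≠ 0} := by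
    refine isOpen_iff_eventually.2 fun v hv => hΦ.eventually_forall_of_forall_eventually
      fun φ hφ => ?_
    have hcont : Continuous fun p : E × (E →L[ℂ] ℂ) => p.2 p.1 := by fun_prop
    exact hcont.continuousAt.eventually_ne (hv φ hφ)
  have hsome : IsOpen {v : E | ∃ ψ ∈ Ψ, ψ v ≠ 0} := by
    simp only [ofPred_exists, ← exists_prop]
    exact isOpen_iUnion fun ψ => isOpen_iUnion fun _ => isOpen_ne_fun ψ.continuous continuous_const
  exact hnonvanishing.inter hsome

theorem continuousOn_norm_ratio :
    ContinuousOn (fun q : ((E →L[ℂ] ℂ) × (E →L[ℂ] ℂ)) × E => ‖q.1.2 q.2 / q.1.1 q.2‖)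
      ((Φ ×ˢ Ψ) ×ˢ ratioDomain Φ Ψ) :=
  (ContinuousOn.div (by fun_prop) (by fun_prop) fun q hq => hq.2.1 q.1.1 hq.1.1).norm

theorem exists_ratio_ne_zero (hΦne : Φ.Nonempty) {v : E} (hv : v ∈ ratioDomain Φ Ψ) :
    ∃ p ∈ Φ ×ˢ Ψ, p.2 v / p.1 v ≠ 0 :=
  let ⟨φ, hφ⟩ := hΦne
  let ⟨ψ, hψ, hψv⟩ := hv.2
  ⟨(φ, ψ), ⟨hφ, hψ⟩, div_ne_zero hψv (hv.1 φ hφ)⟩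

theorem supRatio_pos (hΦ : IsCompact Φ) (hΨ : IsCompact Ψ) (hΦne : Φ.Nonempty) {v : E}
    (hv : v ∈ ratioDomain Φ Ψ) : 0 < supRatio Φ Ψ v :=
  sSup_image_norm_pos (F := fun (p : (E →L[ℂ] ℂ) × (E →L[ℂ] ℂ)) v => p.2 v / p.1 v)
    (hΦ.prod hΨ) continuousOn_norm_ratio hv (exists_ratio_ne_zero hΦne hv)

theorem norm_ratio_le_supRatio (hΦ : IsCompact Φ) (hΨ : IsCompact Ψ) {v : E}
    (hv : v ∈ ratioDomain Φ Ψ) {φ ψ : E →L[ℂ] ℂ} (hφ : φ ∈ Φ) (hψ : ψ ∈ Ψ) :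
    ‖ψ v / φ v‖ ≤ supRatio Φ Ψ v :=
  norm_le_sSup_image_norm (F := fun p v => p.2 v / p.1 v) (hΦ.prod hΨ) continuousOn_norm_ratio hv
    (mk_mem_prod hφ hψ)

theorem continuousOn_log_supRatio (hΦ : IsCompact Φ) (hΨ : IsCompact Ψ) (hΦne : Φ.Nonempty) :
    ContinuousOn (fun v => Real.log (supRatio Φ Ψ v)) (ratioDomain Φ Ψ) :=
  continuousOn_log_sSup_image_norm (hΦ.prod hΨ) continuousOn_norm_ratio
    fun _ hv => exists_ratio_ne_zero hΦne hv

theorem isPlurisubharmonicOn_log_supRatio (hΦ : IsCompact Φ) (hΨ : IsCompact Ψ)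
    (hΦne : Φ.Nonempty) :
    IsPlurisubharmonicOn (fun v => Real.log (supRatio Φ Ψ v)) (ratioDomain Φ Ψ) :=
  isPlurisubharmonicOn_log_sSup_image_norm (hΦ.prod hΨ) continuousOn_norm_ratio
    (fun p hp => (p.2.analyticOnNhd _).div (p.1.analyticOnNhd _) fun _ hv => hv.1 p.1 hp.1)
    fun _ hv => exists_ratio_ne_zero hΦne hv

theorem isClosed_forall_norm_le (C : ℝ) :
    IsClosed {v : E | ∀ φ ∈ Φ, ∀ ψ ∈ Ψ, ‖ψ v‖ ≤ C * ‖φ v‖} := by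
  simp only [ofPred_forall]
  exact isClosed_biInter fun φ _ => isClosed_biInter fun ψ _ =>
    isClosed_le (by fun_prop) (by fun_prop)

theorem isExhaustionOn_log_supRatio [ProperSpace E] (hΦ : IsCompact Φ) (hΨ : IsCompact Ψ)
    (hΦne : Φ.Nonempty) (hΨ₀ : ∀ v ≠ 0, ∃ ψ ∈ Ψ, ψ v ≠ 0) :
    IsExhaustionOn (fun ω : Projectivization ℂ E => Real.log (supRatio Φ Ψ ω.rep))
      (Projectivization.rep ⁻¹' ratioDomain Φ Ψ) := by
  refine ⟨continuousOn_comp_rep (fun a v => by rw [supRatio_smul]) smul_mem_ratioDomain_iff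
    (isOpen_ratioDomain hΦ) (continuousOn_log_supRatio hΦ hΨ hΦne), fun c => ?_⟩
  have := compactSpace_projectivization (𝕜 := ℂ) (V := E)
  let sublevel : Set E := {v | ∀ φ ∈ Φ, ∀ ψ ∈ Ψ, ‖ψ v‖ ≤ Real.exp c * ‖φ v‖}
  have hinv (a : ℂˣ) (v : E) : a • v ∈ sublevel ↔ v ∈ sublevel := by
    simp [sublevel, Units.smul_def, mul_left_comm (Real.exp c)]
  refine ⟨Projectivization.rep ⁻¹' sublevel,
    (isClosed_preimage_rep hinv (isClosed_forall_norm_le _)).isCompact, ?_, ?_⟩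
  · intro ω hω
    obtain ⟨ψ, hψ, hψω⟩ := hΨ₀ ω.rep ω.rep_nonzero
    refine ⟨fun φ hφ hφω => hψω ?_, ψ, hψ, hψω⟩
    simpa [hφω] using hω φ hφ ψ hψ
  · rintro ω ⟨hω, hlt⟩ φ hφ ψ hψ
    rw [← div_le_iff₀ (norm_pos_iff.2 (hω.1 φ hφ)), ← norm_div]
    calc ‖ψ ω.rep / φ ω.rep‖ ≤ supRatio Φ Ψ ω.rep := norm_ratio_le_supRatio hΦ hΨ hω hφ hψ
      _ ≤ Real.exp c := ((Real.log_lt_iff_lt_exp (supRatio_pos hΦ hΨ hΦne hω)).1 hlt).le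

theorem isPSHOn_log_supRatio {n : ℕ} {Φ Ψ : Set ((Fin (n + 1) → ℂ) →L[ℂ] ℂ)}
    (hΦ : IsCompact Φ) (hΨ : IsCompact Ψ) (hΦne : Φ.Nonempty) :
    IsPSHOn (fun ω => Real.log (supRatio Φ Ψ ω.rep))
      (Projectivization.rep ⁻¹' ratioDomain Φ Ψ) :=
  isPSHOn_comp_rep (fun a v => by rw [supRatio_smul]) smul_mem_ratioDomain_iff
    (isPlurisubharmonicOn_log_supRatio hΦ hΨ hΦne)

end RatioOfForms

section NormalizedLift

variable {E : Type*} [NormedAddCommGroup E] [NormedSpace ℂ E]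

/-- The lift of a projective class of forms that takes the value `1` at `v₀`; it is `0` if the
class vanishes at `v₀`. This is the affine chart of the dual projective space given by `v₀`. -/
noncomputable def normalizedLift (v₀ : E) (φ : Projectivization ℂ (E →L[ℂ] ℂ)) : E →L[ℂ] ℂ :=
  (φ.rep v₀)⁻¹ • φ.rep

theorem continuousOn_normalizedLift (v₀ : E) :
    ContinuousOn (normalizedLift v₀) {φ | φ.rep v₀ ≠ 0} := by
  refine continuousOn_comp_rep (u := fun f : E →L[ℂ] ℂ => (f v₀)⁻¹ • f)
    (S := {f : E →L[ℂ] ℂ | f v₀ ≠ 0}) (fun a f => ?_) (fun a f => by simp [Units.smul_def])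
    (isOpen_ne_fun (by fun_prop) continuous_const)
    (ContinuousOn.smul (ContinuousOn.inv₀ (by fun_prop) fun _ hf => hf) continuousOn_id)
  simp [Units.smul_def, smul_smul]

theorem isCompact_image_normalizedLift [FiniteDimensional ℂ E]
    {Λ : Set (Projectivization ℂ (E →L[ℂ] ℂ))} (hΛ : IsClosed Λ) {v₀ : E}
    (hv₀ : ∀ φ ∈ Λ, φ.rep v₀ ≠ 0) : IsCompact (normalizedLift v₀ '' Λ) := by
  have := FiniteDimensional.proper ℂ (E →L[ℂ] ℂ)
  have := compactSpace_projectivization (𝕜 := ℂ) (V := E →L[ℂ] ℂ)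
  exact hΛ.isCompact.image_of_continuousOn ((continuousOn_normalizedLift v₀).mono hv₀)

theorem normalizedLift_apply_ne_zero_iff {v₀ : E} {φ : Projectivization ℂ (E →L[ℂ] ℂ)}
    (hφ : φ.rep v₀ ≠ 0) (v : E) : normalizedLift v₀ φ v ≠ 0 ↔ φ.rep v ≠ 0 := by
  simp [normalizedLift, hφ]

end NormalizedLift

section Hilbert

variable {n : ℕ} {Λ : Set (CPDual n)} {ω₀ : CP n}

theorem crossRatio_eq_normalizedLift_div (φ φ' : CPDual n) (ω₀ ω : CP n) :
    crossRatio φ φ' ω₀ ω =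
      normalizedLift ω₀.rep φ' ω.rep / normalizedLift ω₀.rep φ ω.rep := by
  simp only [crossRatio, normalizedLift, FunLike.coe_smul, Pi.smul_apply, smul_eq_mul,
    div_eq_mul_inv, mul_inv, inv_inv]
  ring

theorem hilbertDist_eq_log_supRatio (Λ : Set (CPDual n)) (ω₀ ω : CP n) :
    hilbertDist Λ ω₀ ω =
      Real.log (supRatio (normalizedLift ω₀.rep '' Λ) (normalizedLift ω₀.rep '' Λ) ω.rep) := by
  simp only [hilbertDist, supRatio, crossRatio_eq_normalizedLift_div, prod_image_image_eq,
    image_image]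
  congr 2
  ext r
  simp [eq_comm, and_assoc]

theorem setOf_not_vanishes_eq_preimage_ratioDomain {Ψ : Set ((Fin (n + 1) → ℂ) →L[ℂ] ℂ)}
    (hω₀ : ∀ φ ∈ Λ, ¬ Vanishes φ ω₀)
    (hΨ : ∀ ω : CP n, (∀ φ ∈ Λ, ¬ Vanishes φ ω) → ∃ ψ ∈ Ψ, ψ ω.rep ≠ 0) :
    {ω : CP n | ∀ φ ∈ Λ, ¬ Vanishes φ ω} =
      Projectivization.rep ⁻¹' ratioDomain (normalizedLift ω₀.rep '' Λ) Ψ := by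
  ext ω
  have hiff : (∀ φ ∈ normalizedLift ω₀.rep '' Λ, φ ω.rep ≠ 0) ↔ ∀ φ ∈ Λ, ¬ Vanishes φ ω := by
    rw [forall_mem_image]
    exact forall₂_congr fun φ hφ => normalizedLift_apply_ne_zero_iff (hω₀ φ hφ) ω.rep
  exact ⟨fun hω => ⟨hiff.2 hω, hΨ ω hω⟩, fun hω => hiff.1 hω.1⟩

theorem isPseudoconvex_setOf_not_vanishes (hΛ : IsClosed Λ) (hne : Λ.Nonempty)
    (hω₀ : ∀ φ ∈ Λ, ¬ Vanishes φ ω₀) :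
    IsPseudoconvex {ω : CP n | ∀ φ ∈ Λ, ¬ Vanishes φ ω} := by
  let coordinates : Set ((Fin (n + 1) → ℂ) →L[ℂ] ℂ) := range ContinuousLinearMap.proj
  have hcoord : ∀ v : Fin (n + 1) → ℂ, v ≠ 0 → ∃ ψ ∈ coordinates, ψ v ≠ 0 := fun v hv =>
    let ⟨i, hi⟩ := Function.ne_iff.1 hv
    ⟨_, mem_range_self i, hi⟩
  have hΦ := isCompact_image_normalizedLift hΛ hω₀
  have hΦne := hne.image (normalizedLift ω₀.rep)
  have hΨ : IsCompact coordinates := (finite_range _).isCompact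
  rw [setOf_not_vanishes_eq_preimage_ratioDomain hω₀ fun ω _ => hcoord ω.rep ω.rep_nonzero]
  exact ⟨isOpen_preimage_rep smul_mem_ratioDomain_iff (isOpen_ratioDomain hΦ), _,
    isPSHOn_log_supRatio hΦ hΨ hΦne, isExhaustionOn_log_supRatio hΦ hΨ hΦne hcoord⟩

theorem setOf_not_vanishes_eq_preimage_ratioDomain_self (hne : Λ.Nonempty)
    (hω₀ : ∀ φ ∈ Λ, ¬ Vanishes φ ω₀) :
    {ω : CP n | ∀ φ ∈ Λ, ¬ Vanishes φ ω} = Projectivization.rep ⁻¹'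
      ratioDomain (normalizedLift ω₀.rep '' Λ) (normalizedLift ω₀.rep '' Λ) :=
  setOf_not_vanishes_eq_preimage_ratioDomain hω₀ fun ω hω =>
    let ⟨φ, hφ⟩ := hne
    ⟨_, mem_image_of_mem _ hφ, (normalizedLift_apply_ne_zero_iff (hω₀ φ hφ) ω.rep).2 (hω φ hφ)⟩

theorem isPSHOn_hilbertDist (hΛ : IsClosed Λ) (hne : Λ.Nonempty)
    (hω₀ : ∀ φ ∈ Λ, ¬ Vanishes φ ω₀) :
    IsPSHOn (fun ω => hilbertDist Λ ω₀ ω) {ω | ∀ φ ∈ Λ, ¬ Vanishes φ ω} := by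
  have hΦ := isCompact_image_normalizedLift hΛ hω₀
  rw [setOf_not_vanishes_eq_preimage_ratioDomain_self hne hω₀]
  simp only [hilbertDist_eq_log_supRatio]
  exact isPSHOn_log_supRatio hΦ hΦ (hne.image _)

theorem isExhaustionOn_hilbertDist (hΛ : IsClosed Λ) (hne : Λ.Nonempty)
    (hω₀ : ∀ φ ∈ Λ, ¬ Vanishes φ ω₀) (hspan : ∀ p : CP n, ∃ φ ∈ Λ, ¬ Vanishes φ p) :
    IsExhaustionOn (fun ω => hilbertDist Λ ω₀ ω) {ω | ∀ φ ∈ Λ, ¬ Vanishes φ ω} := by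
  have hΦ := isCompact_image_normalizedLift hΛ hω₀
  rw [setOf_not_vanishes_eq_preimage_ratioDomain_self hne hω₀]
  simp only [hilbertDist_eq_log_supRatio]
  refine isExhaustionOn_log_supRatio hΦ hΦ (hne.image _) fun v hv => ?_
  obtain ⟨φ, hφ, hφv⟩ := hspan (Projectivization.mk ℂ v hv)
  rw [← φ.mk_rep, vanishes_mk] at hφv
  exact ⟨_, mem_image_of_mem _ hφ, (normalizedLift_apply_ne_zero_iff (hω₀ φ hφ) v).2 hφv⟩

end Hilbert

end ComplexHilbert

theorem mainTheorem10 (n : ℕ) (hn : 1 ≤ n)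
    (Ω : Set (ComplexHilbert.CP n)) (Λ : Set (ComplexHilbert.CPDual n))
    (hadm : ComplexHilbert.IsAdmissible Ω Λ) (hsat : ComplexHilbert.IsSaturated Ω Λ) :
    ComplexHilbert.IsPseudoconvex Ω ∧
      ∀ ω₀ ∈ Ω,
        ComplexHilbert.IsPSHOn (fun ω => ComplexHilbert.hilbertDist Λ ω₀ ω) Ω ∧
        ((∀ p : ComplexHilbert.CP n, ∃ φ ∈ Λ, ¬ ComplexHilbert.Vanishes φ p) →
          ComplexHilbert.IsExhaustionOn (fun ω => ComplexHilbert.hilbertDist Λ ω₀ ω) Ω) := by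
  obtain rfl : Ω = {ω | ∀ φ ∈ Λ, ¬ ComplexHilbert.Vanishes φ ω} := hsat
  have hclosed := hadm.isClosed
  have hne := hadm.nonempty_right
  obtain ⟨ω₁, hω₁⟩ := hadm.nonempty_left
  exact ⟨ComplexHilbert.isPseudoconvex_setOf_not_vanishes hclosed hne hω₁, fun ω₀ hω₀ =>
    ⟨ComplexHilbert.isPSHOn_hilbertDist hclosed hne hω₀,
      ComplexHilbert.isExhaustionOn_hilbertDist hclosed hne hω₀⟩⟩
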